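/- **Theorem 8.1 (W. S. Kendall).** Let $W=\{W(u,v);\ u,v\ge 0\}$ be a real-valued two-parameter Brownian sheet on a probability space $(\Omega,\mathcal F,\mathrm P)$, that is, a centered Gaussian process indexed by $[0,\infty)^2$ with covariance $\mathrm E[W(u,v)W(u',v')]=\min(u,u')\min(v,v')$ and almost surely continuous sample functions. Let $s,t>0$ be fixed. Then, with probability one, the level curve of $W$ that goes through $(s,t)$ is totally disconnected, in the following sense: the connected component of the level set $$\{(u,v)\in[0,\infty)^2:\ W(u,v)=W(s,t)\}$$ that contains $(s,t)$ is the single point $\{(s,t)\}$. -/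

import Mathlib

open MeasureTheory ProbabilityTheory
open scoped NNReal

/-- `W` is a (standard, real-valued, two-parameter) Brownian sheet on the probability space
`(Ω, P)`: a centered Gaussian process indexed by the quadrant `[0, ∞) × [0, ∞)`, with covariance
`E[W(u, v) W(u', v')] = min(u, u') min(v, v')` (the area of `[0, u] × [0, v] ∩ [0, u'] × [0, v']`),
and with almost surely continuous sample functions. -/
structure IsBrownianSheet {Ω : Type*} [MeasurableSpace Ω]
    (W : ℝ≥0 × ℝ≥0 → Ω → ℝ) (P : Measure Ω) : Prop where
  isGaussianProcess : IsGaussianProcess W P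
  integral_eq_zero : ∀ p, ∫ ω, W p ω ∂P = 0
  covariance_eq : ∀ p q,
    covariance (W p) (W q) P = ((min p.1 q.1 : ℝ≥0) : ℝ) * ((min p.2 q.2 : ℝ≥0) : ℝ)
  ae_continuous : ∀ᵐ ω ∂P, Continuous fun p ↦ W p ω

open Filter Topology

namespace BrownianSheetLevel

/-! ### Averaging over independent events. -/

section Mixing

/-! Almost surely there are arbitrarily small squares centred at (s, t) on whose whole boundary W
exceeds W(s, t) (`ae_exists_square_incr_pos`). No connected part of the level set crosses such a
boundary, so the component is a point.

To find the squares, view the increments of W around (s, t) at the scales l = 2⁻ⁿ, divided by √l. At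
each scale regress them on one Gaussian variable, `shell`, built from the noise in thin strips on
both sides of (s, t). The result is increment = `residual` + c · `shell`, where c is a nonnegative
multiple of `profile` that does not depend on the scale and is bounded below by some a > 0 on the
boundary of the square. The variables `shell` are i.i.d. across scales, because they come from
disjoint noise. Each residual is independent of the shell of its own scale, and the suprema of the
residuals are tight by Brownian scaling. If a · `shell` exceeds the supremum of |`residual`| at some
scale, the boundary is positive there.

Such a scale exists almost surely (`ae_exists_forall_le_lt`), although residuals at different scales
are dependent. On the event F that there is none, `shell` > K/a forces the residual beyond K, so
{`shell` > K/a} ∩ F has probability at most q · P(F)/2, with q = P(`shell` > K/a) and K chosen by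
tightness. By the law of large numbers F cannot correlate in this way with every term of an i.i.d.
sequence: averaging over the scales gives q · P(F) ≤ q · P(F)/2, hence P(F) = 0. -/

theorem integral_indicator_one_of_nullMeasurable {Ω : Type*} [MeasurableSpace Ω] {μ : Measure Ω}
    {s : Set Ω} (hs : NullMeasurableSet s μ) :
    ∫ ω, s.indicator (1 : Ω → ℝ) ω ∂μ = μ.real s := by
  rw [integral_indicator₀ hs]
  simp

variable {Ω : Type*} [MeasurableSpace Ω] {P : Measure Ω} [IsProbabilityMeasure P]

/-- If pairwise independent events of the same probability `q` all meet `F` in measure at most `c`,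
then `q * P F ≤ c`. -/
theorem measureReal_mul_le_of_pairwise_indepFun {η : ℕ → Ω → ℝ}
    (hind : Pairwise fun i j ↦ IndepFun (η i) (η j) P)
    (hid : ∀ n, IdentDistrib (η n) (η 0) P P) {S : Set ℝ} (hS : MeasurableSet S) {F : Set Ω}
    {c : ℝ} (hF : ∀ n, P.real (η n ⁻¹' S ∩ F) ≤ c) :
    P.real (η 0 ⁻¹' S) * P.real F ≤ c := by
  set f : ℝ → ℝ := S.indicator 1 with hf
  have mf : Measurable f := measurable_one.indicator hS
  have hf1 (x : ℝ) : ‖f x‖ ≤ 1 := by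
    by_cases hx : x ∈ S <;> simp [hf, hx]
  have hη (n : ℕ) : AEMeasurable (η n) P := (hid n).aemeasurable_fst
  have hnull (n : ℕ) : NullMeasurableSet (η n ⁻¹' S) P := (hη n).nullMeasurableSet_preimage hS
  have hcomp (n : ℕ) : f ∘ η n = (η n ⁻¹' S).indicator 1 := by
    funext ω
    by_cases hx : η n ω ∈ S <;> simp [hf, hx]
  have hmeas (n : ℕ) : AEStronglyMeasurable (f ∘ η n) P :=
    (mf.comp_aemeasurable (hη n)).aestronglyMeasurable
  have hint (n : ℕ) : Integrable (f ∘ η n) P :=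
    Integrable.of_bound (hmeas n) 1 (.of_forall fun ω ↦ hf1 _)
  -- The frequency of the events tends almost surely to their common probability; integrating over F
  -- by dominated convergence turns the bounds on each intersection into one on the product.
  have hlaw := strong_law_ae_real (fun n ↦ f ∘ η n) (hint 0)
    (fun i j hij ↦ (hind hij).comp mf mf) (fun n ↦ (hid n).comp mf)
  have hmean : ∫ ω, (f ∘ η 0) ω ∂P = P.real (η 0 ⁻¹' S) := by
    rw [hcomp, integral_indicator_one_of_nullMeasurable (hnull 0)]
  rw [hmean] at hlaw
  have hlim : Tendsto (fun n : ℕ ↦ ∫ ω in F, (∑ i ∈ Finset.range n, (f ∘ η i) ω) / n ∂P) atTop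
      (𝓝 (∫ _ in F, P.real (η 0 ⁻¹' S) ∂P)) := by
    refine tendsto_integral_of_dominated_convergence (fun _ ↦ 1) (fun n ↦ ?_)
      (integrable_const _) (fun n ↦ .of_forall fun ω ↦ ?_) (ae_restrict_of_ae hlaw)
    · refine AEStronglyMeasurable.restrict ?_
      have := Finset.aestronglyMeasurable_fun_sum (Finset.range n) (fun i _ ↦ hmeas i)
      simpa [div_eq_mul_inv] using this.mul_const (n : ℝ)⁻¹
    · rw [norm_div, Real.norm_natCast]
      refine div_le_one_of_le₀ ?_ (Nat.cast_nonneg n)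
      refine (norm_sum_le_of_le _ fun i _ ↦ hf1 (η i ω)).trans ?_
      simp
  have hle (n : ℕ) : ∫ ω in F, (∑ i ∈ Finset.range n, (f ∘ η i) ω) / n ∂P ≤ c := by
    have hc : 0 ≤ c := measureReal_nonneg.trans (hF 0)
    rw [integral_div, integral_finsetSum _ fun i _ ↦ (hint i).restrict]
    refine div_le_of_le_mul₀ (Nat.cast_nonneg n) hc ?_
    refine (Finset.sum_le_card_nsmul _ _ c fun i _ ↦ ?_).trans (by simp [mul_comm])
    rw [hcomp, integral_indicator_one_of_nullMeasurable
      ((hnull i).mono_ac Measure.absolutelyContinuous_restrict)]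
    -- Only the event needs to be null measurable; F is an arbitrary set.
    rw [Measure.real, Measure.restrict_apply₀
      ((hnull i).mono_ac Measure.absolutelyContinuous_restrict)]
    exact hF i
  have := le_of_tendsto' hlim hle
  rwa [setIntegral_const, smul_eq_mul, mul_comm] at this

end Mixing

/-! ### Gaussian calculus on the linear span of a process. -/

section GaussianSpan

variable {Ω T : Type*} [MeasurableSpace Ω] {P : Measure Ω} {X : T → Ω → ℝ}

/-- The linear span of a Gaussian process, indexed by itself, is a Gaussian process. -/
theorem isGaussianProcess_span (hX : IsGaussianProcess X P) :
    IsGaussianProcess (fun Y : Submodule.span ℝ (Set.range X) ↦ (Y : Ω → ℝ)) P := by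
  refine hX.of_isGaussianProcess fun Y ↦ ?_
  obtain ⟨c, hc⟩ := (Finsupp.mem_span_range_iff_exists_finsupp).1 Y.2
  refine ⟨c.support, ∑ i : c.support, c i • ContinuousLinearMap.proj i, fun ω ↦ ?_⟩
  rw [← hc]
  simp only [Finsupp.sum, Finset.sum_apply, Pi.smul_apply, smul_eq_mul,
    sum_apply, smul_apply, ContinuousLinearMap.proj_apply,
    Finset.restrict]
  exact (Finset.sum_coe_sort c.support (fun i ↦ c i * X i ω)).symm

theorem memLp_span (hX : IsGaussianProcess X P) (Y : Submodule.span ℝ (Set.range X)) :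
    MemLp (Y : Ω → ℝ) 2 P :=
  ((isGaussianProcess_span hX).hasGaussianLaw_eval Y).memLp_two

theorem aemeasurable_span (hX : IsGaussianProcess X P) (Y : Submodule.span ℝ (Set.range X)) :
    AEMeasurable (Y : Ω → ℝ) P :=
  (isGaussianProcess_span hX).aemeasurable Y

theorem integral_span_eq_zero (hX : IsGaussianProcess X P) (h0 : ∀ i, ∫ ω, X i ω ∂P = 0)
    (Y : Submodule.span ℝ (Set.range X)) : ∫ ω, (Y : Ω → ℝ) ω ∂P = 0 := by
  obtain ⟨c, hc⟩ := (Finsupp.mem_span_range_iff_exists_finsupp).1 Y.2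
  rw [← hc]
  simp only [Finsupp.sum, Finset.sum_apply, Pi.smul_apply, smul_eq_mul]
  rw [integral_finsetSum]
  · simp [integral_const_mul, h0]
  · exact fun i _ ↦ (hX.hasGaussianLaw_eval i).integrable.const_mul _

/-- Covariance as a bilinear form on the linear span of a Gaussian process. -/
noncomputable def covForm (hX : IsGaussianProcess X P) :
    Submodule.span ℝ (Set.range X) →ₗ[ℝ] Submodule.span ℝ (Set.range X) →ₗ[ℝ] ℝ :=
  haveI := hX.isProbabilityMeasure
  LinearMap.mk₂ ℝ (fun Y Z ↦ cov[(Y : Ω → ℝ), (Z : Ω → ℝ); P])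
    (fun Y Y' Z ↦ covariance_add_left (memLp_span hX Y) (memLp_span hX Y') (memLp_span hX Z))
    (fun c _ _ ↦ covariance_smul_left c)
    (fun Y Z Z' ↦ covariance_add_right (memLp_span hX Y) (memLp_span hX Z) (memLp_span hX Z'))
    (fun c _ _ ↦ covariance_smul_right c)

theorem covForm_apply (hX : IsGaussianProcess X P) (Y Z : Submodule.span ℝ (Set.range X)) :
    covForm hX Y Z = cov[(Y : Ω → ℝ), (Z : Ω → ℝ); P] := rfl

/-- Centered Gaussian processes with the same covariance have the same law. -/
theorem identDistrib_of_covariance_eq {ι : Type*} [Countable ι] {U V : ι → Ω → ℝ}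
    (hU : IsGaussianProcess U P) (hV : IsGaussianProcess V P)
    (hU0 : ∀ i, ∫ ω, U i ω ∂P = 0) (hV0 : ∀ i, ∫ ω, V i ω ∂P = 0)
    (h : ∀ i j, cov[U i, U j; P] = cov[V i, V j; P]) :
    IdentDistrib (fun ω i ↦ U i ω) (fun ω i ↦ V i ω) P P := by
  classical
  have := hU.isProbabilityMeasure
  have mU : AEMeasurable (fun ω i ↦ U i ω) P := aemeasurable_pi_lambda _ hU.aemeasurable
  have mV : AEMeasurable (fun ω i ↦ V i ω) P := aemeasurable_pi_lambda _ hV.aemeasurable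
  refine ⟨mU, mV, (map_eq_iff_forall_finset_map_restrict_eq mU mV).2 fun I ↦ ?_⟩
  have gU := hU.hasGaussianLaw I
  have gV := hV.hasGaussianLaw I
  have := gU.isGaussian_map
  have := gV.isGaussian_map
  refine Measure.ext_of_charFunDual (funext fun L ↦ ?_)
  have key (x : I → ℝ) : L x = ∑ i, L (Pi.single i 1) * x i := by
    conv_lhs => rw [← Finset.univ_sum_single x, map_sum]
    refine Finset.sum_congr rfl fun i _ ↦ ?_
    have : (Pi.single i (x i) : I → ℝ) = x i • Pi.single i 1 := by
      rw [← Pi.single_smul]; simp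
    rw [this, map_smul, smul_eq_mul, mul_comm]
  rw [gU.charFunDual_map_eq_fun, gV.charFunDual_map_eq_fun]
  have hmean (Z : ι → Ω → ℝ) (hZ : IsGaussianProcess Z P) (hZ0 : ∀ i, ∫ ω, Z i ω ∂P = 0) :
      ∫ ω, L (I.restrict (Z · ω)) ∂P = 0 := by
    simp_rw [fun ω ↦ key (I.restrict (Z · ω)), Finset.restrict]
    rw [integral_finsetSum]
    · simp [integral_const_mul, hZ0]
    · exact fun i _ ↦ (hZ.hasGaussianLaw_eval i).integrable.const_mul _
  have hvar (Z : ι → Ω → ℝ) (hZ : IsGaussianProcess Z P) :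
      Var[fun ω ↦ L (I.restrict (Z · ω)); P]
        = ∑ i : I, ∑ j : I, L (Pi.single i 1) * (L (Pi.single j 1) * cov[Z i, Z j; P]) := by
    simp_rw [fun ω ↦ key (I.restrict (Z · ω)), Finset.restrict]
    rw [variance_fun_sum]
    · simp [covariance_const_mul_left, covariance_const_mul_right, mul_left_comm]
    · exact fun i ↦ (hZ.hasGaussianLaw_eval i).memLp_two.const_mul _
  rw [hmean U hU hU0, hmean V hV hV0, hvar U hU, hvar V hV]
  simp [h]

/-- Processes in the linear span of a Gaussian process are Gaussian. -/
theorem isGaussianProcess_of_span (hX : IsGaussianProcess X P) {ι : Type*}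
    (U : ι → Submodule.span ℝ (Set.range X)) :
    IsGaussianProcess (fun i ↦ (U i : Ω → ℝ)) P :=
  (isGaussianProcess_span hX).comp_right U

/-- Everything in the span is jointly Gaussian, so zero covariances give independence from the whole
family at once. -/
theorem indepFun_of_covForm_eq_zero (hX : IsGaussianProcess X P) {ι : Type*}
    (U : ι → Submodule.span ℝ (Set.range X)) (Y : Submodule.span ℝ (Set.range X))
    (h : ∀ i, covForm hX (U i) Y = 0) :
    IndepFun (fun ω i ↦ (U i : Ω → ℝ) ω) (Y : Ω → ℝ) P := by
  have hG := isGaussianProcess_of_span hX (Sum.elim U (fun _ : Unit ↦ Y))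
  have hG' : IsGaussianProcess
      (Sum.elim (fun i ↦ (U i : Ω → ℝ)) (fun _ : Unit ↦ (Y : Ω → ℝ))) P := by
    convert! hG using 1
    funext i
    cases i <;> rfl
  have := hG'.indepFun_of_covariance_eq_zero (fun i ↦ aemeasurable_span hX _)
    (fun _ ↦ aemeasurable_span hX _) (fun i _ ↦ h i)
  exact this.comp (φ := id) (ψ := fun x : Unit → ℝ ↦ x ()) measurable_id (measurable_pi_apply _)

/-- Uniform tightness of the suprema of a sequence of centered Gaussian processes which are, in law,
rescalings of a single almost surely bounded process. -/
theorem exists_forall_measureReal_sup_le (hX : IsGaussianProcess X P)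
    (h0 : ∀ i, ∫ ω, X i ω ∂P = 0) (U : ℕ → ℕ → Submodule.span ℝ (Set.range X))
    (V : ℕ → Submodule.span ℝ (Set.range X)) {c : ℕ → ℝ} (hc : ∀ n, 0 < c n)
    (hcov : ∀ n i j, covForm hX (U n i) (U n j) = c n ^ 2 * covForm hX (V i) (V j))
    (hb : ∀ᵐ ω ∂P, ∃ K : ℝ, ∀ i, |(V i : Ω → ℝ) ω| ≤ K) {ε : ℝ} (hε : 0 < ε) :
    ∃ K : ℝ, ∀ K' ≥ K, ∀ n, P.real {ω | ∃ i, K' * c n < |(U n i : Ω → ℝ) ω|} ≤ ε := by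
  have := hX.isProbabilityMeasure
  have hS (K : ℝ) : MeasurableSet {x : ℕ → ℝ | ∃ i, K < |x i|} := by
    simp only [Set.ofPred_exists]
    exact .iUnion fun i ↦ measurableSet_lt measurable_const (measurable_pi_apply i).abs
  have hV : AEMeasurable (fun ω i ↦ (V i : Ω → ℝ) ω) P :=
    aemeasurable_pi_lambda _ fun i ↦ aemeasurable_span hX _
  have hlaw (K : ℝ) (n : ℕ) : P {ω | ∃ i, K * c n < |(U n i : Ω → ℝ) ω|} =
      P {ω | ∃ i, K < |(V i : Ω → ℝ) ω|} := by
    -- After division by `c n` the process has the law of `V`, so the probability does not depend on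
    -- n.
    have hid := identDistrib_of_covariance_eq
      (isGaussianProcess_of_span hX fun i ↦ (c n)⁻¹ • U n i) (isGaussianProcess_of_span hX V)
      (fun i ↦ integral_span_eq_zero hX h0 _) (fun i ↦ integral_span_eq_zero hX h0 _)
      (fun i j ↦ by
        rw [← covForm_apply hX, ← covForm_apply hX, map_smul, map_smul, LinearMap.smul_apply, hcov]
        have := (hc n).ne'
        simp only [smul_eq_mul]
        field_simp)
    have := hid.measure_mem_eq (hS K)
    refine Eq.trans (congrArg P ?_) this
    ext ω
    simp only [Set.mem_ofPred_eq, Set.mem_preimage, Submodule.coe_smul, Pi.smul_apply, smul_eq_mul,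
      abs_mul, abs_inv, abs_of_pos (hc n)]
    refine exists_congr fun i ↦ ?_
    rw [inv_mul_eq_div, lt_div_iff₀ (hc n)]
  have hlim := tendsto_measure_iInter_atTop (μ := P)
    (s := fun K : ℕ ↦ {ω | ∃ i, (K : ℝ) < |(V i : Ω → ℝ) ω|})
    (fun K ↦ hV.nullMeasurableSet_preimage (hS K))
    (fun K K' hK ω ↦ fun ⟨i, hi⟩ ↦ ⟨i, lt_of_le_of_lt (Nat.cast_le.2 hK) hi⟩)
    ⟨0, measure_ne_top _ _⟩
  have hnull : P (⋂ K : ℕ, {ω | ∃ i, (K : ℝ) < |(V i : Ω → ℝ) ω|}) = 0 := by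
    refine measure_mono_null (t := {ω | ¬ ∃ K : ℝ, ∀ i, |(V i : Ω → ℝ) ω| ≤ K}) ?_ (ae_iff.1 hb)
    rintro ω hω ⟨K, hK⟩
    obtain ⟨k, hk⟩ := exists_nat_ge K
    obtain ⟨i, hi⟩ := Set.mem_iInter.1 hω k
    exact absurd (hK i) (not_le.2 (hk.trans_lt hi))
  rw [hnull] at hlim
  obtain ⟨K, hK⟩ := (hlim.eventually (ge_mem_nhds (ENNReal.ofReal_pos.2 hε))).exists
  refine ⟨K, fun K' hK' n ↦ ENNReal.toReal_le_of_le_ofReal hε.le ?_⟩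
  rw [hlaw]
  refine (measure_mono ?_).trans hK
  rintro ω ⟨i, hi⟩
  exact ⟨i, lt_of_le_of_lt hK' hi⟩

theorem identDistrib_of_covForm_self_eq (hX : IsGaussianProcess X P)
    (h0 : ∀ i, ∫ ω, X i ω ∂P = 0) {Y Z : Submodule.span ℝ (Set.range X)}
    (h : covForm hX Y Y = covForm hX Z Z) : IdentDistrib (Y : Ω → ℝ) (Z : Ω → ℝ) P P := by
  have := identDistrib_of_covariance_eq
      (isGaussianProcess_of_span hX fun _ : Unit ↦ Y) (isGaussianProcess_of_span hX fun _ ↦ Z)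
      (fun i ↦ integral_span_eq_zero hX h0 _) (fun i ↦ integral_span_eq_zero hX h0 _)
      (fun i j ↦ h)
  exact this.comp (measurable_pi_apply ())

theorem measureReal_Ioi_pos (hX : IsGaussianProcess X P) {Y : Submodule.span ℝ (Set.range X)}
    (h : 0 < covForm hX Y Y) (N : ℝ) : 0 < P.real ((Y : Ω → ℝ) ⁻¹' Set.Ioi N) := by
  have := hX.isProbabilityMeasure
  have hY := (isGaussianProcess_span hX).hasGaussianLaw_eval Y
  refine ENNReal.toReal_pos (fun h' ↦ ?_) (measure_ne_top _ _)
  rw [← Measure.map_apply_of_aemeasurable hY.aemeasurable measurableSet_Ioi,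
    hY.map_eq_gaussianReal] at h'
  rw [covForm_apply, covariance_self hY.aemeasurable] at h
  have := gaussianReal_absolutelyContinuous' (∫ ω, (Y : Ω → ℝ) ω ∂P)
    (Real.toNNReal_pos.2 h).ne' h'
  simp at this

/-- Let `η` be i.i.d. nondegenerate Gaussian variables and `R n` Gaussian processes, uniformly
tight, with `R n` independent of `η n`. Then almost surely some `η n` dominates `R n`. -/
theorem ae_exists_forall_le_lt (hX : IsGaussianProcess X P)
    (h0 : ∀ i, ∫ ω, X i ω ∂P = 0) (η : ℕ → Submodule.span ℝ (Set.range X))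
    (R : ℕ → ℕ → Submodule.span ℝ (Set.range X)) {v : ℝ} (hv : 0 < v)
    (hη : ∀ n, covForm hX (η n) (η n) = v)
    (hηη : ∀ m n, m ≠ n → covForm hX (η m) (η n) = 0)
    (hRη : ∀ n i, covForm hX (R n i) (η n) = 0)
    (hR : ∀ ε > 0, ∃ K : ℝ, ∀ n, P.real {ω | ∃ i, K < |(R n i : Ω → ℝ) ω|} ≤ ε)
    {a : ℝ} (ha : 0 < a) :
    ∀ᵐ ω ∂P, ∃ n, ∃ K : ℝ, (∀ i, |(R n i : Ω → ℝ) ω| ≤ K) ∧ K < a * (η n : Ω → ℝ) ω := by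
  have := hX.isProbabilityMeasure
  rw [ae_iff]
  by_contra hne
  set bad := {ω | ¬ ∃ n, ∃ K : ℝ, (∀ i, |(R n i : Ω → ℝ) ω| ≤ K) ∧ K < a * (η n : Ω → ℝ) ω}
    with hbad
  have hpos : 0 < P.real bad := ENNReal.toReal_pos hne (measure_ne_top _ _)
  -- Half of the supposedly positive probability leaves a factor 1/2 for the final contradiction.
  obtain ⟨K, hK⟩ := hR (P.real bad / 2) (half_pos hpos)
  have hid (n : ℕ) := identDistrib_of_covForm_self_eq hX h0 ((hη n).trans (hη 0).symm)
  have hind : Pairwise fun i j ↦ IndepFun (η i : Ω → ℝ) (η j : Ω → ℝ) P := fun i j hij ↦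
    (indepFun_of_covForm_eq_zero hX (fun _ : Unit ↦ η i) (η j) fun _ ↦ hηη i j hij).comp
      (φ := fun x : Unit → ℝ ↦ x ()) (ψ := id) (measurable_pi_apply _) measurable_id
  have hS : MeasurableSet {x : ℕ → ℝ | ∃ i, K < |x i|} := by
    simp only [Set.ofPred_exists]
    exact .iUnion fun i ↦ measurableSet_lt measurable_const (measurable_pi_apply i).abs
  set q := P.real ((η 0 : Ω → ℝ) ⁻¹' Set.Ioi (K / a)) with hq
  have hq0 : 0 < q := measureReal_Ioi_pos hX ((hη 0).symm ▸ hv) _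
  have hqn (n : ℕ) : P.real ((η n : Ω → ℝ) ⁻¹' Set.Ioi (K / a)) = q :=
    congrArg ENNReal.toReal ((hid n).measure_mem_eq measurableSet_Ioi)
  have hle := measureReal_mul_le_of_pairwise_indepFun (P := P) (η := fun n ↦ (η n : Ω → ℝ)) hind hid
    (measurableSet_Ioi (a := K / a)) (F := bad) (c := P.real bad / 2 * q) fun n ↦ by
      have hprod := (indepFun_of_covForm_eq_zero hX (R n) (η n)
        (hRη n)).measure_inter_preimage_eq_mul _ _
        hS (measurableSet_Ioi (a := K / a))
      have hprod' := congrArg ENNReal.toReal hprod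
      rw [ENNReal.toReal_mul] at hprod'
      calc P.real ((η n : Ω → ℝ) ⁻¹' Set.Ioi (K / a) ∩ bad)
          ≤ P.real ((fun ω i ↦ (R n i : Ω → ℝ) ω) ⁻¹' {x : ℕ → ℝ | ∃ i, K < |x i|} ∩
              (η n : Ω → ℝ) ⁻¹' Set.Ioi (K / a)) := by
            refine measureReal_mono (fun ω ⟨h1, h2⟩ ↦ ⟨?_, h1⟩) (measure_ne_top _ _)
            by_contra h3
            simp only [Set.mem_preimage, Set.mem_ofPred_eq, not_exists, not_lt] at h3
            refine h2 ⟨n, K, h3, ?_⟩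
            rw [mul_comm]
            exact (div_lt_iff₀ ha).1 h1
        _ = _ := hprod'
        _ ≤ _ := mul_le_mul (hK n) (hqn n).le measureReal_nonneg (half_pos hpos).le
  have : q * P.real bad ≤ q * (P.real bad / 2) := by rw [mul_comm q (P.real bad / 2)]; exact hle
  have := le_of_mul_le_mul_left this hq0
  linarith

end GaussianSpan

/-! ### Overlaps of intervals, strips and rectangles. -/

/-- The signed length of the overlap of the intervals between `0` and `a`, and `0` and `b`. -/
noncomputable def overlap (a b : ℝ) : ℝ := (|a| + |b| - |a - b|) / 2

/-- The left side is the covariance of the increments of a Brownian motion from x to x + a and from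
x to x + b. -/
theorem overlap_eq_min (x a b : ℝ) :
    min (x + a) (x + b) - min (x + a) x - min x (x + b) + x = overlap a b := by
  simp only [overlap, min_def, abs_eq_max_neg, max_def]
  split_ifs <;> linarith

theorem overlap_mul_mul {c : ℝ} (hc : 0 ≤ c) (a b : ℝ) :
    overlap (c * a) (c * b) = c * overlap a b := by
  simp only [overlap, ← mul_sub, abs_mul, abs_of_nonneg hc]
  ring

/-- One of the two overlaps vanishes, according to the sign of a. This is why `cross` adds the
strips on both sides: its covariance with a displacement depends only on the absolute value. -/
theorem overlap_add_overlap_neg {r : ℝ} (hr : 0 ≤ r) (a : ℝ) :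
    overlap a r + overlap a (-r) = min |a| r := by
  simp only [overlap, min_def, abs_eq_max_neg, max_def]
  split_ifs <;> linarith

section Strips

variable {Ω : Type*} {W : ℝ≥0 × ℝ≥0 → Ω → ℝ}

variable (W) in
/-- The value of the sheet at a point with real coordinates, as an element of the span. -/
noncomputable def val (u v : ℝ) : Submodule.span ℝ (Set.range W) :=
  ⟨W (u.toNNReal, v.toNNReal), Submodule.subset_span (Set.mem_range_self _)⟩

variable (W) in
/-- The increment of the sheet over the vertical strip between `s` and `s + h`, up to height `v`. -/
noncomputable def vstrip (s h v : ℝ) : Submodule.span ℝ (Set.range W) :=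
  val W (s + h) v - val W s v

variable (W) in
/-- The increment of the sheet over the horizontal strip between `t` and `t + k`, up to
abscissa `u`. -/
noncomputable def hstrip (t k u : ℝ) : Submodule.span ℝ (Set.range W) :=
  val W u (t + k) - val W u t

variable (W) in
/-- The increment `W (s + h, t + k) - W (s, t)`. -/
noncomputable def incr (s t h k : ℝ) : Submodule.span ℝ (Set.range W) :=
  val W (s + h) (t + k) - val W s t

variable (W) in
/-- The increment over the rectangle spanned by `(s, t)` and `(s + h, t + k)`. -/
noncomputable def rect (s t h k : ℝ) : Submodule.span ℝ (Set.range W) :=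
  vstrip W s h (t + k) - vstrip W s h t

variable (W) in
/-- The linear functional of the sheet in whose direction its paths are pushed up around
`(s, t)`. -/
noncomputable def cross (s t r : ℝ) : Submodule.span ℝ (Set.range W) :=
  (vstrip W s r (t / 2) + vstrip W s (-r) (t / 2)) +
    (hstrip W t r (s / 2) + hstrip W t (-r) (s / 2))

theorem incr_eq (s t h k : ℝ) : incr W s t h k = vstrip W s h (t + k) + hstrip W t k s := by
  simp [incr, vstrip, hstrip]

theorem incr_eq_add_add (s t h k : ℝ) :
    incr W s t h k = vstrip W s h t + hstrip W t k s + rect W s t h k := by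
  rw [incr_eq, rect]
  abel

end Strips

/-! ### Covariances of strips, rectangles and crosses. -/

section Sheet

variable {Ω : Type*} [MeasurableSpace Ω] {P : Measure Ω} {W : ℝ≥0 × ℝ≥0 → Ω → ℝ}
  (hW : IsBrownianSheet W P)

theorem covForm_val {u v u' v' : ℝ} (hu : 0 ≤ u) (hv : 0 ≤ v)
    (hu' : 0 ≤ u') (hv' : 0 ≤ v') :
    covForm hW.isGaussianProcess (val W u v) (val W u' v') = min u u' * min v v' := by
  rw [covForm_apply]
  refine (hW.covariance_eq _ _).trans ?_
  simp [NNReal.coe_min, hu, hv, hu', hv']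

theorem covForm_vstrip_vstrip {s h h' v v' : ℝ} (hs : 0 ≤ s) (hh : 0 ≤ s + h) (hh' : 0 ≤ s + h')
    (hv : 0 ≤ v) (hv' : 0 ≤ v') :
    covForm hW.isGaussianProcess (vstrip W s h v) (vstrip W s h' v') =
      overlap h h' * min v v' := by
  simp only [vstrip, map_sub, LinearMap.sub_apply, covForm_val hW, hs, hh, hh', hv, hv']
  rw [← overlap_eq_min s, min_self]
  ring

theorem covForm_hstrip_hstrip {t k k' u u' : ℝ} (ht : 0 ≤ t) (hk : 0 ≤ t + k) (hk' : 0 ≤ t + k')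
    (hu : 0 ≤ u) (hu' : 0 ≤ u') :
    covForm hW.isGaussianProcess (hstrip W t k u) (hstrip W t k' u') =
      overlap k k' * min u u' := by
  simp only [hstrip, map_sub, LinearMap.sub_apply, covForm_val hW, ht, hk, hk', hu, hu']
  rw [← overlap_eq_min t, min_self]
  ring

theorem covForm_vstrip_hstrip {s t h k u v : ℝ} (hs : 0 ≤ s) (hh : 0 ≤ s + h) (ht : 0 ≤ t)
    (hk : 0 ≤ t + k) (hu : 0 ≤ u) (hv : 0 ≤ v) :
    covForm hW.isGaussianProcess (vstrip W s h v) (hstrip W t k u) =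
      (min (s + h) u - min s u) * (min v (t + k) - min v t) := by
  simp only [hstrip, vstrip, map_sub, LinearMap.sub_apply, covForm_val hW, ht, hk, hs, hh, hu, hv]
  ring

theorem covForm_hstrip_vstrip {s t h k u v : ℝ} (hs : 0 ≤ s) (hh : 0 ≤ s + h) (ht : 0 ≤ t)
    (hk : 0 ≤ t + k) (hu : 0 ≤ u) (hv : 0 ≤ v) :
    covForm hW.isGaussianProcess (hstrip W t k u) (vstrip W s h v) =
      (min u (s + h) - min u s) * (min (t + k) v - min t v) := by
  simp only [hstrip, vstrip, map_sub, LinearMap.sub_apply, covForm_val hW, ht, hk, hs, hh, hu, hv]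
  ring

theorem covForm_rect_rect {s t h k h' k' : ℝ} (hs : 0 ≤ s) (hh : 0 ≤ s + h) (hh' : 0 ≤ s + h')
    (ht : 0 ≤ t) (hk : 0 ≤ t + k) (hk' : 0 ≤ t + k') :
    covForm hW.isGaussianProcess (rect W s t h k) (rect W s t h' k') =
      overlap h h' * overlap k k' := by
  simp only [rect, map_sub, LinearMap.sub_apply, covForm_vstrip_vstrip hW, ht, hk, hs, hh, hk', hh']
  rw [← overlap_eq_min t k, min_self]
  ring

/-- Cutting the arms of the cross at t / 2 and s / 2 keeps the vertical strips away from the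
horizontal ones, and the overlap with the strips of the increment is then insensitive to the
transverse displacement. The covariance splits into a term in h and a term in k. -/
theorem covForm_incr_cross {s t h k r : ℝ} (hh : |h| ≤ s / 2) (hk : |k| ≤ t / 2) (hr : 0 ≤ r)
    (hrs : r ≤ s / 2) (hrt : r ≤ t / 2) :
    covForm hW.isGaussianProcess (incr W s t h k) (cross W s t r) =
      (t * min |h| r + s * min |k| r) / 2 := by
  have h1 := abs_le.1 hh
  have h2 := abs_le.1 hk
  have hs : 0 ≤ s := by linarith
  have ht : 0 ≤ t := by linarith
  simp only [incr_eq, cross, map_add, LinearMap.add_apply]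
  rw [covForm_vstrip_vstrip hW, covForm_vstrip_vstrip hW, covForm_vstrip_hstrip hW,
    covForm_vstrip_hstrip hW, covForm_hstrip_hstrip hW, covForm_hstrip_hstrip hW,
    covForm_hstrip_vstrip hW, covForm_hstrip_vstrip hW, ← overlap_add_overlap_neg hr,
    ← overlap_add_overlap_neg hr, min_eq_right (a := t + k) (b := t / 2),
    min_eq_right (a := t) (b := t / 2), min_eq_right (a := s + h) (b := s / 2),
    min_eq_right (a := s) (b := s / 2)]
  · ring
  all_goals linarith

/-- As a process in r, the cross is a Brownian motion of variance s + t per unit, hence has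
independent increments. -/
theorem covForm_cross_cross {s t r r' : ℝ} (hr : 0 ≤ r) (hrs : r ≤ s / 2) (hrt : r ≤ t / 2)
    (hr' : 0 ≤ r') (hrs' : r' ≤ s / 2) (hrt' : r' ≤ t / 2) :
    covForm hW.isGaussianProcess (cross W s t r) (cross W s t r') = (s + t) * min r r' := by
  have hs : 0 ≤ s := by linarith
  have ht : 0 ≤ t := by linarith
  have e1 := overlap_add_overlap_neg hr' r
  have e2 := overlap_add_overlap_neg hr' (-r)
  rw [abs_of_nonneg hr] at e1
  rw [abs_neg, abs_of_nonneg hr] at e2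
  simp only [cross, map_add, LinearMap.add_apply]
  rw [covForm_vstrip_vstrip hW, covForm_vstrip_vstrip hW, covForm_vstrip_vstrip hW,
    covForm_vstrip_vstrip hW, covForm_hstrip_hstrip hW, covForm_hstrip_hstrip hW,
    covForm_hstrip_hstrip hW, covForm_hstrip_hstrip hW, covForm_vstrip_hstrip hW,
    covForm_vstrip_hstrip hW, covForm_vstrip_hstrip hW, covForm_vstrip_hstrip hW,
    covForm_hstrip_vstrip hW, covForm_hstrip_vstrip hW, covForm_hstrip_vstrip hW,
    covForm_hstrip_vstrip hW, min_eq_right (a := s + r) (b := s / 2),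
    min_eq_right (a := s + -r) (b := s / 2), min_eq_right (a := s) (b := s / 2),
    min_eq_right (a := t + r) (b := t / 2),
    min_eq_right (a := t + -r) (b := t / 2), min_eq_right (a := t) (b := t / 2), min_self, min_self]
  · linear_combination (t / 2 + s / 2) * e1 + (t / 2 + s / 2) * e2
  all_goals linarith

end Sheet

/-! ### The deterministic profile on a square. -/

section Square

/-- The closed square of half-side `ρ` centered at the origin. -/
abbrev square (ρ : ℝ) : Set (ℝ × ℝ) := Set.Icc (-ρ) ρ ×ˢ Set.Icc (-ρ) ρ

theorem mem_square {ρ : ℝ} {p : ℝ × ℝ} : p ∈ square ρ ↔ |p.1| ≤ ρ ∧ |p.2| ≤ ρ := by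
  simp only [square, Set.mem_prod, Set.mem_Icc, abs_le]

/-- The profile in whose direction the paths of the sheet are pushed up around `(s, t)`. -/
noncomputable def profile (s t ρ : ℝ) (p : ℝ × ℝ) : ℝ :=
  (t * (|p.1| - min |p.1| (ρ / 2)) + s * (|p.2| - min |p.2| (ρ / 2))) / 2

theorem continuous_profile (s t ρ : ℝ) : Continuous (profile s t ρ) := by
  unfold profile
  fun_prop

theorem abs_sub_min_nonneg (x c : ℝ) : 0 ≤ |x| - min |x| c := sub_nonneg.2 (min_le_left _ _)

theorem profile_nonneg {s t : ℝ} (hs : 0 ≤ s) (ht : 0 ≤ t) (ρ : ℝ) (p : ℝ × ℝ) :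
    0 ≤ profile s t ρ p :=
  div_nonneg (add_nonneg (mul_nonneg ht (abs_sub_min_nonneg _ _))
    (mul_nonneg hs (abs_sub_min_nonneg _ _))) zero_le_two

theorem profile_le {s t ρ : ℝ} (hs : 0 ≤ s) (ht : 0 ≤ t) (hρ : 0 ≤ ρ) {p : ℝ × ℝ}
    (hp : p ∈ square ρ) : profile s t ρ p ≤ (s + t) * (ρ / 2) := by
  have key {x : ℝ} (hx : |x| ≤ ρ) : |x| - min |x| (ρ / 2) ≤ ρ / 2 := by
    rcases min_cases |x| (ρ / 2) with h | h <;> linarith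
  have h1 := mul_le_mul_of_nonneg_left (key (mem_square.1 hp).1) ht
  have h2 := mul_le_mul_of_nonneg_left (key (mem_square.1 hp).2) hs
  have h3 : 0 ≤ s * ρ := mul_nonneg hs hρ
  have h4 : 0 ≤ t * ρ := mul_nonneg ht hρ
  unfold profile
  linarith

theorem le_profile {s t ρ : ℝ} (hs : 0 ≤ s) (ht : 0 ≤ t) (hρ : 0 ≤ ρ) {p : ℝ × ℝ}
    (hp : |p.1| = ρ ∨ |p.2| = ρ) : min s t * ρ / 4 ≤ profile s t ρ p := by
  have h1 := mul_nonneg ht (abs_sub_min_nonneg p.1 (ρ / 2))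
  have h2 := mul_nonneg hs (abs_sub_min_nonneg p.2 (ρ / 2))
  have hm : min ρ (ρ / 2) = ρ / 2 := min_eq_right (by linarith)
  unfold profile
  rcases hp with hp | hp
  · have := mul_le_mul_of_nonneg_right (min_le_right s t) hρ
    rw [hp, hm] at h1 ⊢
    linarith
  · have := mul_le_mul_of_nonneg_right (min_le_left s t) hρ
    rw [hp, hm] at h2 ⊢
    linarith

end Square

/-! ### Rescaling, regression on the shells and the good square. -/

section Sheet

variable {Ω : Type*} [MeasurableSpace Ω] {P : Measure Ω} {W : ℝ≥0 × ℝ≥0 → Ω → ℝ}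
  (hW : IsBrownianSheet W P)

theorem continuous_val {Ω : Type*} {W : ℝ≥0 × ℝ≥0 → Ω → ℝ} {ω : Ω}
    (hω : Continuous fun p ↦ W p ω) {α : Type*}
    [TopologicalSpace α] {f g : α → ℝ} (hf : Continuous f) (hg : Continuous g) :
    Continuous fun a ↦ (val W (f a) (g a) : Ω → ℝ) ω :=
  hω.comp ((continuous_real_toNNReal.comp hf).prodMk (continuous_real_toNNReal.comp hg))

/-- The covariance of two functionals of the sheet normalized by `√l`. -/
theorem covForm_sqrt_inv_smul (hW : IsBrownianSheet W P) {l : ℝ} (hl : 0 < l)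
    (Y Z : Submodule.span ℝ (Set.range W)) :
    covForm hW.isGaussianProcess ((√l)⁻¹ • Y) ((√l)⁻¹ • Z) =
      l⁻¹ * covForm hW.isGaussianProcess Y Z := by
  rw [map_smul, map_smul, LinearMap.smul_apply, smul_eq_mul, smul_eq_mul, ← mul_assoc, ← mul_inv,
    Real.mul_self_sqrt hl.le]

variable (W) in
/-- The normalized increment of `cross` between the scales `l / 2` and `l`. -/
noncomputable def shell (s t ρ l : ℝ) : Submodule.span ℝ (Set.range W) :=
  (√l)⁻¹ • (cross W s t (l * ρ) - cross W s t (l * (ρ / 2)))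

variable {s t ρ : ℝ}

theorem scale_le {l x : ℝ} (hl : 0 < l) (hl1 : l ≤ 1) (hρ : 0 < ρ) (hx : ρ ≤ x) :
    0 ≤ l * ρ ∧ l * ρ ≤ x ∧ 0 ≤ l * (ρ / 2) ∧ l * (ρ / 2) ≤ x := by
  have h1 := mul_le_mul_of_nonneg_right hl1 hρ.le
  have h2 := mul_pos hl hρ
  refine ⟨h2.le, ?_, ?_, ?_⟩ <;> linarith

theorem abs_scale_le {l x h : ℝ} (hl : 0 < l) (hl1 : l ≤ 1) (hh : |h| ≤ ρ) (hx : ρ ≤ x) :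
    |l * h| ≤ x := by
  rw [abs_mul, abs_of_pos hl]
  exact (mul_le_of_le_one_left (abs_nonneg _) hl1).trans (hh.trans hx)

theorem nonneg_add_scale {l x h : ℝ} (hl : 0 < l) (hl1 : l ≤ 1) (hh : |h| ≤ ρ) (hρ : 0 < ρ)
    (hx : ρ ≤ x / 2) : 0 ≤ x + l * h := by
  have := (abs_le.1 (abs_scale_le hl hl1 hh hx)).1
  linarith

theorem covForm_shell_self (hW : IsBrownianSheet W P) (hρ : 0 < ρ) (hs : ρ ≤ s / 2)
    (ht : ρ ≤ t / 2) {l : ℝ} (hl : 0 < l)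
    (hl1 : l ≤ 1) :
    covForm hW.isGaussianProcess (shell W s t ρ l) (shell W s t ρ l) = (s + t) * (ρ / 2) := by
  obtain ⟨a1, a2, a3, a4⟩ := scale_le hl hl1 hρ hs
  obtain ⟨-, b2, -, b4⟩ := scale_le hl hl1 hρ ht
  rw [shell, covForm_sqrt_inv_smul hW hl]
  simp only [map_sub, LinearMap.sub_apply]
  rw [covForm_cross_cross hW a1 a2 b2 a1 a2 b2, covForm_cross_cross hW a3 a4 b4 a1 a2 b2,
    covForm_cross_cross hW a1 a2 b2 a3 a4 b4, covForm_cross_cross hW a3 a4 b4 a3 a4 b4,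
    min_self, min_self, min_eq_left (by linarith), min_eq_right (by linarith)]
  field_simp
  ring

/-- When l' ≤ l / 2, the ranges of r from lρ/2 to lρ and from l'ρ/2 to l'ρ do not overlap, so these
are increments of a Brownian motion over disjoint intervals. -/
theorem covForm_shell_shell (hW : IsBrownianSheet W P) (hρ : 0 < ρ) (hs : ρ ≤ s / 2)
    (ht : ρ ≤ t / 2) {l l' : ℝ} (hl : 0 < l) (hl1 : l ≤ 1) (hl' : 0 < l') (hll' : l' ≤ l / 2) :
    covForm hW.isGaussianProcess (shell W s t ρ l) (shell W s t ρ l') = 0 := by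
  have hl1' : l' ≤ 1 := by linarith
  obtain ⟨a1, a2, a3, a4⟩ := scale_le hl hl1 hρ hs
  obtain ⟨-, b2, -, b4⟩ := scale_le hl hl1 hρ ht
  obtain ⟨a1', a2', a3', a4'⟩ := scale_le hl' hl1' hρ hs
  obtain ⟨-, b2', -, b4'⟩ := scale_le hl' hl1' hρ ht
  have h1 := mul_le_mul_of_nonneg_right hll' hρ.le
  rw [shell, shell, map_smul, map_smul, LinearMap.smul_apply]
  simp only [map_sub, LinearMap.sub_apply]
  rw [covForm_cross_cross hW a1 a2 b2 a1' a2' b2', covForm_cross_cross hW a3 a4 b4 a1' a2' b2',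
    covForm_cross_cross hW a1 a2 b2 a3' a4' b4', covForm_cross_cross hW a3 a4 b4 a3' a4' b4',
    min_eq_right (by linarith), min_eq_right (by linarith), min_eq_right (by linarith),
    min_eq_right (by linarith)]
  simp

theorem covForm_incr_shell (hW : IsBrownianSheet W P) (hρ : 0 < ρ) (hs : ρ ≤ s / 2)
    (ht : ρ ≤ t / 2) {l : ℝ} (hl : 0 < l)
    (hl1 : l ≤ 1) {p : ℝ × ℝ} (hp : p ∈ square ρ) :
    covForm hW.isGaussianProcess ((√l)⁻¹ • incr W s t (l * p.1) (l * p.2)) (shell W s t ρ l) =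
      profile s t ρ p := by
  obtain ⟨a1, a2, a3, a4⟩ := scale_le hl hl1 hρ hs
  obtain ⟨-, b2, -, b4⟩ := scale_le hl hl1 hρ ht
  obtain ⟨h1, h2⟩ := mem_square.1 hp
  have h1' := abs_scale_le hl hl1 h1 hs
  have h2' := abs_scale_le hl hl1 h2 ht
  rw [shell, covForm_sqrt_inv_smul hW hl, map_sub, covForm_incr_cross hW h1' h2' a1 a2 b2,
    covForm_incr_cross hW h1' h2' a3 a4 b4]
  simp only [abs_mul, abs_of_pos hl, ← mul_min_of_nonneg _ _ hl.le, min_eq_left h1,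
    min_eq_left h2, profile]
  field_simp
  ring

theorem isCompact_square (ρ : ℝ) : IsCompact (square ρ) := isCompact_Icc.prod isCompact_Icc

theorem exists_bound_of_continuous {f : ℝ × ℝ → ℝ} (hf : Continuous f) (p : ℕ → square ρ) :
    ∃ K, ∀ i, |f (p i)| ≤ K := by
  obtain ⟨K, hK⟩ := (isCompact_square ρ).exists_bound_of_continuousOn hf.continuousOn
  exact ⟨K, fun i ↦ hK _ (p i).2⟩

/-- The part of the normalized increment that is independent of `shell`. -/
noncomputable def residual (W : ℝ≥0 × ℝ≥0 → Ω → ℝ) (s t ρ l : ℝ) (p : ℝ × ℝ) :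
    Submodule.span ℝ (Set.range W) :=
  (√l)⁻¹ • incr W s t (l * p.1) (l * p.2) -
    (profile s t ρ p / ((s + t) * (ρ / 2))) • shell W s t ρ l

theorem covForm_residual_shell (hW : IsBrownianSheet W P) (hρ : 0 < ρ) (hs : ρ ≤ s / 2)
    (ht : ρ ≤ t / 2) {l : ℝ} (hl : 0 < l)
    (hl1 : l ≤ 1) {p : ℝ × ℝ} (hp : p ∈ square ρ) :
    covForm hW.isGaussianProcess (residual W s t ρ l p) (shell W s t ρ l) = 0 := by
  have : s + t ≠ 0 := by linarith
  rw [residual, map_sub, LinearMap.sub_apply, covForm_incr_shell hW hρ hs ht hl hl1 hp, map_smul,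
    LinearMap.smul_apply, covForm_shell_self hW hρ hs ht hl hl1, smul_eq_mul,
    div_mul_cancel₀ _ (by positivity), sub_self]

/-- The residual splits into a vertical strip, a horizontal strip, a rectangle and a multiple of the
shell. Each is in law a rescaling of a fixed almost surely bounded process, so each gets a share ε /
4. -/
theorem exists_forall_measureReal_residual_le (hW : IsBrownianSheet W P) (hρ : 0 < ρ)
    (hs : ρ ≤ s / 2) (ht : ρ ≤ t / 2)
    {l : ℕ → ℝ} (hl : ∀ n, 0 < l n) (hl1 : ∀ n, l n ≤ 1) (p : ℕ → square ρ) {ε : ℝ} (hε : 0 < ε) :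
    ∃ K : ℝ, ∀ n, P.real {ω | ∃ i, K < |(residual W s t ρ (l n) (p i) : Ω → ℝ) ω|} ≤ ε := by
  have hG := hW.isGaussianProcess
  have := hG.isProbabilityMeasure
  have hs0 : 0 ≤ s := by linarith
  have ht0 : 0 ≤ t := by linarith
  have hp1 (i : ℕ) := (mem_square.1 (p i).2).1
  have hp2 (i : ℕ) := (mem_square.1 (p i).2).2
  have hx (n i : ℕ) : 0 ≤ s + l n * (p i : ℝ × ℝ).1 := nonneg_add_scale (hl n) (hl1 n) (hp1 i) hρ hs
  have hy (n i : ℕ) : 0 ≤ t + l n * (p i : ℝ × ℝ).2 := nonneg_add_scale (hl n) (hl1 n) (hp2 i) hρ ht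
  have hx0 (i : ℕ) : 0 ≤ s + (p i : ℝ × ℝ).1 := by
    simpa using nonneg_add_scale one_pos le_rfl (hp1 i) hρ hs
  have hy0 (i : ℕ) : 0 ≤ t + (p i : ℝ × ℝ).2 := by
    simpa using nonneg_add_scale one_pos le_rfl (hp2 i) hρ ht
  obtain ⟨K₁, hK₁⟩ := exists_forall_measureReal_sup_le hG hW.integral_eq_zero
    (fun n i ↦ (√(l n))⁻¹ • vstrip W s (l n * (p i : ℝ × ℝ).1) t)
    (fun i ↦ vstrip W s (p i : ℝ × ℝ).1 t) (c := fun _ ↦ 1) (fun _ ↦ one_pos)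
    (fun n i j ↦ by
      rw [covForm_sqrt_inv_smul hW (hl n), covForm_vstrip_vstrip hW hs0 (hx n i) (hx n j) ht0 ht0,
        covForm_vstrip_vstrip hW hs0 (hx0 i) (hx0 j) ht0 ht0, overlap_mul_mul (hl n).le]
      have := (hl n).ne'
      field_simp)
    (by
      filter_upwards [hW.ae_continuous] with ω hω
      exact exists_bound_of_continuous (f := fun q ↦ (vstrip W s q.1 t : Ω → ℝ) ω)
        ((continuous_val hω (by fun_prop) (by fun_prop)).sub
          (continuous_val hω (by fun_prop) (by fun_prop))) p)
    (show 0 < ε / 4 by positivity)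
  obtain ⟨K₂, hK₂⟩ := exists_forall_measureReal_sup_le hG hW.integral_eq_zero
    (fun n i ↦ (√(l n))⁻¹ • hstrip W t (l n * (p i : ℝ × ℝ).2) s)
    (fun i ↦ hstrip W t (p i : ℝ × ℝ).2 s) (c := fun _ ↦ 1) (fun _ ↦ one_pos)
    (fun n i j ↦ by
      rw [covForm_sqrt_inv_smul hW (hl n), covForm_hstrip_hstrip hW ht0 (hy n i) (hy n j) hs0 hs0,
        covForm_hstrip_hstrip hW ht0 (hy0 i) (hy0 j) hs0 hs0, overlap_mul_mul (hl n).le]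
      have := (hl n).ne'
      field_simp)
    (by
      filter_upwards [hW.ae_continuous] with ω hω
      exact exists_bound_of_continuous (f := fun q ↦ (hstrip W t q.2 s : Ω → ℝ) ω)
        ((continuous_val hω (by fun_prop) (by fun_prop)).sub
          (continuous_val hω (by fun_prop) (by fun_prop))) p)
    (show 0 < ε / 4 by positivity)
  -- The rectangle scales in both directions: its covariance is of order l², so after division by √l
  -- a factor √l ≤ 1 is left over.
  obtain ⟨K₃, hK₃⟩ := exists_forall_measureReal_sup_le hG hW.integral_eq_zero
    (fun n i ↦ (√(l n))⁻¹ • rect W s t (l n * (p i : ℝ × ℝ).1) (l n * (p i : ℝ × ℝ).2))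
    (fun i ↦ rect W s t (p i : ℝ × ℝ).1 (p i : ℝ × ℝ).2) (c := fun n ↦ √(l n))
    (fun n ↦ Real.sqrt_pos.2 (hl n))
    (fun n i j ↦ by
      rw [covForm_sqrt_inv_smul hW (hl n),
        covForm_rect_rect hW hs0 (hx n i) (hx n j) ht0 (hy n i) (hy n j),
        covForm_rect_rect hW hs0 (hx0 i) (hx0 j) ht0 (hy0 i) (hy0 j),
        overlap_mul_mul (hl n).le, overlap_mul_mul (hl n).le, Real.sq_sqrt (hl n).le]
      have := (hl n).ne'
      field_simp)
    (by
      filter_upwards [hW.ae_continuous] with ω hω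
      exact exists_bound_of_continuous (f := fun q ↦ (rect W s t q.1 q.2 : Ω → ℝ) ω)
        (((continuous_val hω (by fun_prop) (by fun_prop)).sub
          (continuous_val hω (by fun_prop) (by fun_prop))).sub
          ((continuous_val hω (by fun_prop) (by fun_prop)).sub
          (continuous_val hω (by fun_prop) (by fun_prop)))) p)
    (show 0 < ε / 4 by positivity)
  obtain ⟨K₄, hK₄⟩ := exists_forall_measureReal_sup_le hG hW.integral_eq_zero
    (fun n _ ↦ shell W s t ρ (l n)) (fun _ ↦ shell W s t ρ 1) (c := fun _ ↦ 1) (fun _ ↦ one_pos)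
    (fun n i j ↦ by
      rw [covForm_shell_self hW hρ hs ht (hl n) (hl1 n),
        covForm_shell_self hW hρ hs ht one_pos le_rfl]
      ring)
    (.of_forall fun ω ↦ ⟨_, fun _ ↦ le_rfl⟩)
    (show 0 < ε / 4 by positivity)
  set K := max (max K₁ K₂) (max (max K₃ K₄) 0)
  have k1 : K₁ ≤ K := by simp [K]
  have k2 : K₂ ≤ K := by simp [K]
  have k3 : K₃ ≤ K := by simp [K]
  have k4 : K₄ ≤ K := by simp [K]
  have k0 : 0 ≤ K := by simp [K]
  refine ⟨4 * K, fun n ↦ ?_⟩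
  have e1 := hK₁ K k1 n
  have e2 := hK₂ K k2 n
  have e3 := hK₃ K k3 n
  have e4 := hK₄ K k4 n
  set S₁ := {ω | ∃ i, K * 1 < |((√(l n))⁻¹ • vstrip W s (l n * (p i : ℝ × ℝ).1) t :
    Submodule.span ℝ (Set.range W)).1 ω|}
  set S₂ := {ω | ∃ i, K * 1 < |((√(l n))⁻¹ • hstrip W t (l n * (p i : ℝ × ℝ).2) s :
    Submodule.span ℝ (Set.range W)).1 ω|}
  set S₃ := {ω | ∃ i, K * √(l n) < |((√(l n))⁻¹ • rect W s t (l n * (p i : ℝ × ℝ).1)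
    (l n * (p i : ℝ × ℝ).2) : Submodule.span ℝ (Set.range W)).1 ω|}
  set S₄ := {ω | ∃ _ : ℕ, K * 1 < |(shell W s t ρ (l n)).1 ω|}
  have hsub : {ω | ∃ i, 4 * K < |(residual W s t ρ (l n) (p i) : Ω → ℝ) ω|} ⊆
      (S₁ ∪ S₂) ∪ (S₃ ∪ S₄) := by
    rintro ω ⟨i, hi⟩
    by_contra hω
    simp only [Set.mem_union, not_or] at hω
    obtain ⟨⟨h1, h2⟩, h3, h4⟩ := hω
    have g1 := not_lt.1 fun h ↦ h1 ⟨i, h⟩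
    have g2 := not_lt.1 fun h ↦ h2 ⟨i, h⟩
    have g3 := not_lt.1 fun h ↦ h3 ⟨i, h⟩
    have g4 := not_lt.1 fun h ↦ h4 ⟨i, h⟩
    have hst : 0 < (s + t) * (ρ / 2) := mul_pos (by linarith) (by linarith)
    have hr1 : profile s t ρ (p i) / ((s + t) * (ρ / 2)) ≤ 1 :=
      div_le_one_of_le₀ (profile_le hs0 ht0 hρ.le (p i).2) hst.le
    have hr0 : 0 ≤ profile s t ρ (p i) / ((s + t) * (ρ / 2)) :=
      div_nonneg (profile_nonneg hs0 ht0 _ _) hst.le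
    have hres : residual W s t ρ (l n) (p i) =
        (√(l n))⁻¹ • vstrip W s (l n * (p i : ℝ × ℝ).1) t +
        (√(l n))⁻¹ • hstrip W t (l n * (p i : ℝ × ℝ).2) s +
        (√(l n))⁻¹ • rect W s t (l n * (p i : ℝ × ℝ).1) (l n * (p i : ℝ × ℝ).2) -
        (profile s t ρ (p i) / ((s + t) * (ρ / 2))) • shell W s t ρ (l n) := by
      rw [residual, incr_eq_add_add, smul_add, smul_add]
    rw [hres, Submodule.coe_sub, Submodule.coe_add, Submodule.coe_add, Pi.sub_apply, Pi.add_apply,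
      Pi.add_apply] at hi
    have g3' : K * √(l n) ≤ K :=
      mul_le_of_le_one_right k0 (Real.sqrt_le_one.2 (hl1 n))
    have g4' : |((profile s t ρ (p i) / ((s + t) * (ρ / 2))) • shell W s t ρ (l n)).1 ω| ≤ K := by
      rw [Submodule.coe_smul, Pi.smul_apply, smul_eq_mul, abs_mul, abs_of_nonneg hr0]
      exact (mul_le_of_le_one_left (abs_nonneg _) hr1).trans (by simpa using g4)
    refine absurd hi (not_lt.2 ?_)
    refine (abs_sub _ _).trans ?_
    have t1 := abs_add_three
      (((√(l n))⁻¹ • vstrip W s (l n * (p i : ℝ × ℝ).1) t :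
        Submodule.span ℝ (Set.range W)).1 ω)
      (((√(l n))⁻¹ • hstrip W t (l n * (p i : ℝ × ℝ).2) s :
        Submodule.span ℝ (Set.range W)).1 ω)
      (((√(l n))⁻¹ • rect W s t (l n * (p i : ℝ × ℝ).1) (l n * (p i : ℝ × ℝ).2) :
        Submodule.span ℝ (Set.range W)).1 ω)
    linarith
  calc _ ≤ P.real ((S₁ ∪ S₂) ∪ (S₃ ∪ S₄)) := measureReal_mono hsub (measure_ne_top _ _)
    _ ≤ (P.real S₁ + P.real S₂) + (P.real S₃ + P.real S₄) :=
      (measureReal_union_le _ _).trans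
        (add_le_add (measureReal_union_le _ _) (measureReal_union_le _ _))
    _ ≤ ε := by linarith

/-- Almost surely, there is a small square around `(s, t)` on whose boundary the sheet exceeds its
value at `(s, t)`. -/
theorem ae_exists_square_incr_pos (hW : IsBrownianSheet W P) (hρ : 0 < ρ) (hs : ρ ≤ s / 2)
    (ht : ρ ≤ t / 2) :
    ∀ᵐ ω ∂P, ∃ r, 0 < r ∧ r ≤ ρ ∧ ∀ h k, |h| ≤ r → |k| ≤ r → (|h| = r ∨ |k| = r) →
      0 < (incr W s t h k : Ω → ℝ) ω := by
  have hs0 : 0 < s := by linarith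
  have ht0 : 0 < t := by linarith
  have hst : 0 < (s + t) * (ρ / 2) := by positivity
  have : Nonempty (square ρ) := ⟨⟨(0, 0), by simp [hρ.le]⟩⟩
  -- A countable dense set suffices for the probabilistic estimates; path continuity extends the
  -- bound to the whole square in `hall`.
  set p := TopologicalSpace.denseSeq (square ρ)
  set l : ℕ → ℝ := fun n ↦ (1 / 2) ^ n
  have hl (n : ℕ) : 0 < l n := by positivity
  have hl1 (n : ℕ) : l n ≤ 1 := pow_le_one₀ (by norm_num) (by norm_num)
  have hll {m n : ℕ} (h : m < n) : l n ≤ l m / 2 := by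
    have := pow_le_pow_of_le_one (a := (1 / 2 : ℝ)) (by norm_num) (by norm_num) h
    rw [pow_succ] at this
    simp only [l]
    linarith
  -- Lower bound, over the boundary of the square, of the regression coefficient on the shell.
  set a := min s t * ρ / 4 / ((s + t) * (ρ / 2))
  have ha : 0 < a := by positivity
  have key := ae_exists_forall_le_lt hW.isGaussianProcess hW.integral_eq_zero
    (fun n ↦ shell W s t ρ (l n)) (fun n i ↦ residual W s t ρ (l n) (p i)) hst
    (fun n ↦ covForm_shell_self hW hρ hs ht (hl n) (hl1 n))
    (fun m n hmn ↦ by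
      rcases hmn.lt_or_gt with h | h
      · exact covForm_shell_shell hW hρ hs ht (hl m) (hl1 m) (hl n) (hll h)
      · rw [covForm_apply, covariance_comm]
        exact covForm_shell_shell hW hρ hs ht (hl n) (hl1 n) (hl m) (hll h))
    (fun n i ↦ covForm_residual_shell hW hρ hs ht (hl n) (hl1 n) (p i).2)
    (fun ε hε ↦ exists_forall_measureReal_residual_le hW hρ hs ht hl hl1 p hε) ha
  filter_upwards [key, hW.ae_continuous] with ω ⟨n, K, hK, hlt⟩ hω
  refine ⟨l n * ρ, mul_pos (hl n) hρ, mul_le_of_le_one_left hρ.le (hl1 n), fun h k hh hk hhk ↦ ?_⟩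
  have hK0 : 0 ≤ K := (abs_nonneg _).trans (hK 0)
  have hη : 0 < (shell W s t ρ (l n)).1 ω := pos_of_mul_pos_right (hK0.trans_lt hlt) ha.le
  have hcont : Continuous fun q : square ρ ↦ |(residual W s t ρ (l n) q : Ω → ℝ) ω| := by
    refine (Continuous.sub ?_ ?_).abs
    · exact continuous_const.mul ((continuous_val hω (by fun_prop) (by fun_prop)).sub
        (continuous_val hω (by fun_prop) (by fun_prop)))
    · exact (((continuous_profile s t ρ).comp continuous_subtype_val).div_const _).mul
        continuous_const
  have hall : ∀ q : square ρ, |(residual W s t ρ (l n) q : Ω → ℝ) ω| ≤ K :=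
    isClosed_property (TopologicalSpace.denseRange_denseSeq (square ρ))
      (isClosed_le hcont continuous_const) hK
  have habs (x : ℝ) : |x / l n| = |x| / l n := by rw [abs_div, abs_of_pos (hl n)]
  have hq : (h / l n, k / l n) ∈ square ρ := by
    rw [mem_square, habs, habs, div_le_iff₀' (hl n), div_le_iff₀' (hl n)]
    exact ⟨hh, hk⟩
  have hb : a ≤ profile s t ρ (h / l n, k / l n) / ((s + t) * (ρ / 2)) := by
    refine div_le_div_of_nonneg_right (le_profile hs0.le ht0.le hρ.le ?_) hst.le
    simp only [habs, div_eq_iff (hl n).ne', mul_comm ρ]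
    exact hhk
  have h1 := (abs_le.1 (hall ⟨_, hq⟩)).1
  have h2 := mul_le_mul_of_nonneg_right hb hη.le
  have h3 : (residual W s t ρ (l n) (h / l n, k / l n) : Ω → ℝ) ω =
      (√(l n))⁻¹ * (incr W s t h k : Ω → ℝ) ω -
        profile s t ρ (h / l n, k / l n) / ((s + t) * (ρ / 2)) * (shell W s t ρ (l n)).1 ω := by
    simp only [residual, mul_div_cancel₀ _ (hl n).ne']
    rfl
  rw [h3] at h1
  -- The residual is at least -K, and the shell contributes at least a times its value, which
  -- exceeds K.
  have h4 : 0 < (√(l n))⁻¹ * (incr W s t h k : Ω → ℝ) ω := by linarith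
  exact pos_of_mul_pos_right h4 (by positivity)

end Sheet

end BrownianSheetLevel

/-! ### From barrier squares to total disconnectedness. -/

theorem theorem8p1 {Ω : Type*} [MeasurableSpace Ω] (P : Measure Ω) [IsProbabilityMeasure P]
    (W : ℝ≥0 × ℝ≥0 → Ω → ℝ) (hW : IsBrownianSheet W P) (s t : ℝ≥0) (hs : 0 < s) (ht : 0 < t) :
    ∀ᵐ ω ∂P,
      connectedComponentIn {p : ℝ≥0 × ℝ≥0 | W p ω = W (s, t) ω} (s, t) = {(s, t)} := by
  have hs' : (0 : ℝ) < s := hs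
  have ht' : (0 : ℝ) < t := ht
  set ρ : ℕ → ℝ := fun j ↦ min (s : ℝ) t / 2 * (1 / (j + 1))
  have hρ (j : ℕ) : 0 < ρ j := by positivity
  have hle (j : ℕ) : ρ j ≤ min (s : ℝ) t / 2 :=
    mul_le_of_le_one_right (by positivity)
      (div_le_one_of_le₀ (le_add_of_nonneg_left (Nat.cast_nonneg j)) (by positivity))
  have hρs (j : ℕ) : ρ j ≤ (s : ℝ) / 2 :=
    (hle j).trans (div_le_div_of_nonneg_right (min_le_left _ _) zero_le_two)
  have hρt (j : ℕ) : ρ j ≤ (t : ℝ) / 2 :=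
    (hle j).trans (div_le_div_of_nonneg_right (min_le_right _ _) zero_le_two)
  have hlim : Tendsto ρ atTop (𝓝 0) := by
    simpa [ρ] using tendsto_one_div_add_atTop_nhds_zero_nat.const_mul (min (s : ℝ) t / 2)
  filter_upwards [ae_all_iff.2 fun j ↦
    BrownianSheetLevel.ae_exists_square_incr_pos hW (hρ j) (hρs j) (hρt j)] with ω hω
  set C := connectedComponentIn {p : ℝ≥0 × ℝ≥0 | W p ω = W (s, t) ω} (s, t)
  have hmem : (s, t) ∈ C := mem_connectedComponentIn rfl
  refine Set.eq_singleton_iff_unique_mem.2 ⟨hmem, fun q hq ↦ ?_⟩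
  by_contra hne
  obtain ⟨j, hj⟩ := (hlim.eventually (gt_mem_nhds (dist_pos.2 hne))).exists
  obtain ⟨r, hr0, hr, hpos⟩ := hω j
  -- The product carries the sup metric, so the sphere of radius r is the boundary of the square. A
  -- component reaching q, at distance more than r, must meet it, where W > W(s, t).
  obtain ⟨z, hz, hzr⟩ := isPreconnected_connectedComponentIn.intermediate_value hmem hq
    (f := fun z ↦ dist z (s, t)) (by fun_prop) (show r ∈ Set.Icc _ _ from
      ⟨by simpa using hr0.le, (hr.trans_lt hj).le⟩)
  have hzW : W z ω = W (s, t) ω :=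
    connectedComponentIn_subset {p : ℝ≥0 × ℝ≥0 | W p ω = W (s, t) ω} (s, t) hz
  simp only [Prod.dist_eq, NNReal.dist_eq] at hzr
  have := hpos (z.1 - s) (z.2 - t) (hzr ▸ le_max_left _ _) (hzr ▸ le_max_right _ _) (by
    rcases max_choice |(z.1 : ℝ) - s| |(z.2 : ℝ) - t| with h | h
    · exact .inl (h.symm.trans hzr)
    · exact .inr (h.symm.trans hzr))
  refine this.ne' ?_
  simp [BrownianSheetLevel.incr, BrownianSheetLevel.val, hzW]
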